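/- Let $d\ge 3$, let $\mathbb S^d\subset\mathbb R^{d+1}$ be the unit sphere with its surface measure $dx$ and spherical distance $d(x,y)=\arccos\langle x,y\rangle$. For $\ell\ge 1$ let $G_{\ell;d}$ be the $\ell$-th Gegenbauer polynomial, i.e. the Jacobi polynomial $P_\ell^{(\frac d2-1,\frac d2-1)}$ normalized so that $G_{\ell;d}(1)=1$, and for integers $q\ge 2$, $1\le r\le q-1$ put $$\mathcal K_\ell(q;r)=\int_{(\mathbb S^d)^4}G_{\ell;d}(\cos d(x_1,x_2))^{r}\,G_{\ell;d}(\cos d(x_2,x_3))^{q-r}\,G_{\ell;d}(\cos d(x_3,x_4))^{r}\,G_{\ell;d}(\cos d(x_1,x_4))^{q-r}\,dx_1dx_2dx_3dx_4 .$$ Then, over $\ell\ge 1$ (in particular as $\ell\to\infty$), with implied constants depending only on $d$: - for $q=3$ and all $r\in\{1,2\}$, $\ \mathcal K_\ell(3;r)=O\big(\ell^{-(2d+\frac{d-5}{2})}\big)$; - for $q=4$ and all $r\in\{1,2,3\}$, $\ \mathcal K_\ell(4;r)=O\big(\ell^{-(2d+\frac{d-3}{2})}\big)$; - for every $q\ge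 5$, $\ \mathcal K_\ell(q;1)=\mathcal K_\ell(q;q-1)=O\big(\ell^{-(2d+\frac{d-1}{2})}\big)$, and $\ \mathcal K_\ell(q;r)=O\big(\ell^{-(3d-1)}\big)$ for all $2\le r\le q-2$. -/

import Mathlib

open MeasureTheory Polynomial

noncomputable section

/-- The unit sphere `𝕊ᵈ` of `ℝᵈ⁺¹`. -/
abbrev UnitSphere (d : ℕ) : Type :=
  Metric.sphere (0 : EuclideanSpace ℝ (Fin (d + 1))) 1

/-- The (unnormalized) surface measure `dx` on `𝕊ᵈ`, i.e. the one for which Lebesgue measure on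
`ℝᵈ⁺¹` is `rᵈ dr dx` in polar coordinates; its total mass is the area of the sphere. -/
def surfaceMeasure (d : ℕ) : Measure (UnitSphere d) :=
  (volume : Measure (EuclideanSpace ℝ (Fin (d + 1)))).toSphere

/-- The spherical (geodesic) distance on `𝕊ᵈ`: the angle between the two unit vectors. -/
def sphericalDist {d : ℕ} (x y : UnitSphere d) : ℝ :=
  InnerProductGeometry.angle (x : EuclideanSpace ℝ (Fin (d + 1)))
    (y : EuclideanSpace ℝ (Fin (d + 1)))

/-- The Jacobi polynomial
`P_n^{(α,β)}(t) = (1/n!) ∑_{m=0}^n (n choose m) (n+α+β+1)⋯(n+α+β+m) (α+m+1)⋯(α+n) ((t-1)/2)^m`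
(with `ascPochhammer ℝ k` evaluated at `x` being `x (x+1) ⋯ (x+k-1)`). -/
def jacobiPoly (n : ℕ) (α β : ℝ) : ℝ[X] :=
  C ((n.factorial : ℝ)⁻¹) * ∑ m ∈ Finset.range (n + 1),
    C ((n.choose m : ℝ) * (ascPochhammer ℝ m).eval (n + α + β + 1) *
      (ascPochhammer ℝ (n - m)).eval (α + m + 1)) * (C (1 / 2) * (X - 1)) ^ m

/-- The `ℓ`-th Gegenbauer polynomial `G_{ℓ;d}`: the Jacobi polynomial with parameters
`α = β = d/2 - 1`, normalized to take the value `1` at `1`. -/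
def gegenbauer (ℓ d : ℕ) (t : ℝ) : ℝ :=
  (jacobiPoly ℓ ((d : ℝ) / 2 - 1) ((d : ℝ) / 2 - 1)).eval t /
    (jacobiPoly ℓ ((d : ℝ) / 2 - 1) ((d : ℝ) / 2 - 1)).eval 1

/-- The kernel `G_{ℓ;d}(cos d(x,y))` on `𝕊ᵈ`. -/
def gegenbauerKernel (ℓ d : ℕ) (x y : UnitSphere d) : ℝ :=
  gegenbauer ℓ d (Real.cos (sphericalDist x y))

/-- The circulant contraction integral `𝒦_ℓ(q;r)` over `(𝕊ᵈ)⁴`, used for `1 ≤ r ≤ q - 1`. -/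
def circulantIntegral (d ℓ q r : ℕ) : ℝ :=
  ∫ x : UnitSphere d × UnitSphere d × UnitSphere d × UnitSphere d,
    gegenbauerKernel ℓ d x.1 x.2.1 ^ r *
      gegenbauerKernel ℓ d x.2.1 x.2.2.1 ^ (q - r) *
      gegenbauerKernel ℓ d x.2.2.1 x.2.2.2 ^ r *
      gegenbauerKernel ℓ d x.1 x.2.2.2 ^ (q - r)
    ∂((surfaceMeasure d).prod ((surfaceMeasure d).prod
      ((surfaceMeasure d).prod (surfaceMeasure d))))

end

/-! Everything follows from two pointwise bounds on `[-1, 1]`: `|G| ≤ 1`, and `|G(cos θ)|² ≤ C (ℓ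
sin θ)^{-(d-1)}` (`exists_gegenbauer_bound`). The first comes from an energy that increases on `[0,
1]`, the second from a Sonin function; both rest on the Gegenbauer equation, and parity covers
negative arguments. Summing the bounds over dyadic angular scales gives `∫ |G|² ≲ ℓ^{-(d-1)}` and `∫
|G|⁴ ≲ ℓ^{-d}`, uniformly in the base point; Cauchy–Schwarz then gives `ℓ^{-(d-1)/2}` for `|G|` and
`ℓ^{1/2-d}` for `|G|³`.

The integrand of `𝒦_ℓ(q;r)` lives on a 4-cycle with alternating exponents `r` and `q - r`. Since
`|G| ≤ 1`, exponents may be lowered, which makes the constants independent of `q`, and one edge may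
be discarded. The remaining path is integrated one vertex at a time from its ends, each edge
contributing a moment. Together with the symmetry `r ↔ q - r`, paths with exponents `(2,1,2)`,
`(3,1,3)`, `(2,2,2)` and `(4,1,4)` settle every case except `q ≥ 5`, `2 ≤ r ≤ q - 2`. There the
cycle `(3,2,3,2)` is used with `u²v² ≤ u⁴ + v⁴` on its two square edges, which leaves two paths of
exponents `3, 4, 3` and hence the rate `2(d - 1/2) + d = 3d - 1`. -/

/-! ### Hypergeometric equation and parity of the Gegenbauer polynomials. -/

/-- The unnormalized coefficients of the Jacobi polynomials with `α = β = d / 2 - 1` in the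
variable `z = (t - 1) / 2`. -/
noncomputable def gegenbauerCoeff (n d m : ℕ) : ℝ :=
  (n.choose m : ℝ) * (ascPochhammer ℝ m).eval ((n : ℝ) + d - 1) *
    (ascPochhammer ℝ (n - m)).eval ((d : ℝ) / 2 + m)

theorem gegenbauerCoeff_succ (n d m : ℕ) :
    ((m : ℝ) + 1) * (m + d / 2) * gegenbauerCoeff n d (m + 1) =
      ((n : ℝ) - m) * (n + m + d - 1) * gegenbauerCoeff n d m := by
  unfold gegenbauerCoeff
  rcases lt_or_ge m n with h | h
  · obtain ⟨k, rfl⟩ : ∃ k, n = m + 1 + k := ⟨n - (m + 1), by omega⟩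
    have h1 : m + 1 + k - m = k + 1 := by omega
    have h2 : m + 1 + k - (m + 1) = k := by omega
    rw [h1, h2, ascPochhammer_succ_eval, ascPochhammer_succ_left]
    have h3 := Nat.choose_succ_right_eq (m + 1 + k) m
    rw [h1] at h3
    have h4 : ((m + 1 + k).choose (m + 1) : ℝ) * (m + 1) = (m + 1 + k).choose m * (k + 1) := by
      exact_mod_cast h3
    simp only [eval_mul, eval_X, eval_comp, eval_add, eval_one]
    push_cast
    rw [show (d : ℝ) / 2 + (m + 1) = d / 2 + m + 1 by ring]
    linear_combination ((m : ℝ) + d / 2) * eval ((m : ℝ) + 1 + k + d - 1) (ascPochhammer ℝ m) *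
      ((m : ℝ) + 1 + k + d - 1 + m) * eval ((d : ℝ) / 2 + m + 1) (ascPochhammer ℝ k) * h4
  · rw [Nat.choose_eq_zero_of_lt (by omega : n < m + 1)]
    rcases eq_or_lt_of_le h with h | h
    · subst h; simp
    · rw [Nat.choose_eq_zero_of_lt h]; simp

theorem gegenbauerCoeff_zero_pos (n d : ℕ) (hd : 1 ≤ d) : 0 < gegenbauerCoeff n d 0 := by
  have : (0 : ℝ) < d := by exact_mod_cast hd
  simpa [gegenbauerCoeff] using ascPochhammer_pos n ((d : ℝ) / 2) (by positivity)

/-- The normalized Gegenbauer polynomial in the variable `z = (t - 1) / 2`. -/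
noncomputable def shiftedGegenbauer (n d : ℕ) : ℝ[X] :=
  ∑ m ∈ Finset.range (n + 1), C (gegenbauerCoeff n d m / gegenbauerCoeff n d 0) * X ^ m

theorem shiftedGegenbauer_coeff (n d m : ℕ) :
    (shiftedGegenbauer n d).coeff m = gegenbauerCoeff n d m / gegenbauerCoeff n d 0 := by
  simp only [shiftedGegenbauer, finsetSum_coeff, coeff_C_mul, coeff_X_pow, mul_ite, mul_one,
    mul_zero, Finset.sum_ite_eq, Finset.mem_range]
  split_ifs with h
  · rfl
  · simp [gegenbauerCoeff, Nat.choose_eq_zero_of_lt (by omega : n < m)]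

theorem gegenbauer_eq_eval (n d : ℕ) (t : ℝ) :
    gegenbauer n d t = (shiftedGegenbauer n d).eval ((t - 1) / 2) := by
  have key : ∀ u : ℝ, (jacobiPoly n ((d : ℝ) / 2 - 1) ((d : ℝ) / 2 - 1)).eval u =
      (n.factorial : ℝ)⁻¹ * ∑ m ∈ Finset.range (n + 1),
        gegenbauerCoeff n d m * ((u - 1) / 2) ^ m := by
    intro u
    simp only [jacobiPoly, eval_mul, eval_C, eval_finsetSum, eval_pow, eval_sub, eval_X, eval_one,
      gegenbauerCoeff]
    congr 1
    refine Finset.sum_congr rfl fun m _ => ?_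
    rw [show (n : ℝ) + ((d : ℝ) / 2 - 1) + ((d : ℝ) / 2 - 1) + 1 = n + d - 1 by ring,
      show (d : ℝ) / 2 - 1 + m + 1 = d / 2 + m by ring]
    ring
  have h1 : ∑ m ∈ Finset.range (n + 1), gegenbauerCoeff n d m * (((1 : ℝ) - 1) / 2) ^ m =
      gegenbauerCoeff n d 0 := by
    rw [Finset.sum_range_succ']
    simp
  rw [gegenbauer, key, key, h1, mul_div_mul_left _ _ (by positivity), shiftedGegenbauer,
    eval_finsetSum, Finset.sum_div]
  refine Finset.sum_congr rfl fun m _ => ?_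
  simp only [eval_mul, eval_C, eval_pow, eval_X]
  ring

/-- The hypergeometric equation in the variable `z = (t - 1) / 2`. -/
def IsGegenbauerSolution (n d : ℕ) (p : ℝ[X]) : Prop :=
  X * (1 + X) * derivative (derivative p) + C ((d : ℝ) / 2) * (1 + 2 * X) * derivative p =
    C ((n : ℝ) * (n + d - 1)) * p

theorem isGegenbauerSolution_iff (n d : ℕ) (p : ℝ[X]) :
    IsGegenbauerSolution n d p ↔ ∀ m : ℕ, ((m : ℝ) + 1) * (m + d / 2) * p.coeff (m + 1) =
      ((n : ℝ) - m) * (n + m + d - 1) * p.coeff m := by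
  have e : X * (1 + X) * derivative (derivative p) +
      C ((d : ℝ) / 2) * (1 + 2 * X) * derivative p =
      derivative (derivative p) * X + derivative (derivative p) * X ^ 2 +
      C ((d : ℝ) / 2) * derivative p + C (d : ℝ) * (derivative p * X) := by
    have : (C (d : ℝ) : ℝ[X]) = 2 * C ((d : ℝ) / 2) := by
      rw [show (2 : ℝ[X]) = C 2 from rfl, ← C_mul]; congr 1; ring
    rw [this]; ring
  rw [IsGegenbauerSolution, e, Polynomial.ext_iff]
  refine forall_congr' fun m => ?_
  rw [← sub_eq_zero, ← sub_eq_zero (b := _ * p.coeff m)]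
  simp only [coeff_add, coeff_C_mul]
  rcases m with _ | _ | m
  · simp [coeff_derivative, coeff_X_pow, mul_coeff_zero]
  · simp [coeff_derivative, coeff_mul_X, coeff_mul_X_pow']
    constructor <;> intro h <;> linear_combination h
  · simp [coeff_derivative, coeff_mul_X, coeff_mul_X_pow']
    constructor <;> intro h <;> linear_combination h

theorem isGegenbauerSolution_shiftedGegenbauer (n d : ℕ) :
    IsGegenbauerSolution n d (shiftedGegenbauer n d) := by
  rw [isGegenbauerSolution_iff]
  intro m
  rw [shiftedGegenbauer_coeff, shiftedGegenbauer_coeff]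
  linear_combination (gegenbauerCoeff n d 0)⁻¹ * gegenbauerCoeff_succ n d m

/-- The factor `(m + 1)(m + d/2)` in the coefficient recurrence never vanishes, so the constant
coefficient determines all the others. -/
theorem IsGegenbauerSolution.eq_C_mul {n d : ℕ} (hd : 1 ≤ d) {p : ℝ[X]}
    (hp : IsGegenbauerSolution n d p) : p = C (p.coeff 0) * shiftedGegenbauer n d := by
  ext m
  rw [coeff_C_mul]
  have hd' : (0 : ℝ) < d := by exact_mod_cast hd
  induction m with
  | zero =>
    rw [shiftedGegenbauer_coeff, div_self (gegenbauerCoeff_zero_pos n d hd).ne', mul_one]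
  | succ m ih =>
    have h1 := (isGegenbauerSolution_iff n d p).1 hp m
    have h2 := (isGegenbauerSolution_iff n d _).1 (isGegenbauerSolution_shiftedGegenbauer n d) m
    have h3 : ((m : ℝ) + 1) * (m + d / 2) ≠ 0 := by positivity
    refine mul_left_cancel₀ h3 ?_
    rw [h1, ih]
    linear_combination -(p.coeff 0) * h2

/-- The map `z ↦ -1 - z` is `t ↦ -t` in the original variable, and the equation is invariant under
it. -/
theorem IsGegenbauerSolution.reflect {n d : ℕ} {p : ℝ[X]} (hp : IsGegenbauerSolution n d p) :
    IsGegenbauerSolution n d (p.comp (-1 - X)) := by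
  have h := congrArg (fun r => r.comp (-1 - X : ℝ[X])) hp
  simp only [IsGegenbauerSolution, derivative_comp, derivative_mul, mul_comp, add_comp, C_comp,
    X_comp, one_comp, derivative_sub, derivative_neg, derivative_one, derivative_X] at h ⊢
  have h2 : (2 : ℝ[X]).comp (-1 - X) = 2 := by
    rw [show (2 : ℝ[X]) = C 2 from rfl, C_comp]
  rw [h2] at h
  simp only [derivative_zero, neg_zero]
  linear_combination h

theorem gegenbauer_one (n d : ℕ) (hd : 1 ≤ d) : gegenbauer n d 1 = 1 := by
  rw [gegenbauer_eq_eval, sub_self, zero_div, ← coeff_zero_eq_eval_zero, shiftedGegenbauer_coeff,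
    div_self (gegenbauerCoeff_zero_pos n d hd).ne']

theorem gegenbauer_neg (n d : ℕ) (hd : 1 ≤ d) (t : ℝ) :
    gegenbauer n d (-t) = gegenbauer n d (-1) * gegenbauer n d t := by
  have h := ((isGegenbauerSolution_shiftedGegenbauer n d).reflect).eq_C_mul hd
  have h2 := congrArg (fun r => r.eval ((t - 1) / 2)) h
  simp only [eval_comp, eval_sub, eval_neg, eval_one, eval_X, eval_mul, eval_C,
    coeff_zero_eq_eval_zero] at h2
  rw [gegenbauer_eq_eval, gegenbauer_eq_eval, gegenbauer_eq_eval]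
  rw [show (-t - 1) / 2 = -1 - (t - 1) / 2 by ring, h2]
  norm_num

/-- Parity is needed only up to sign: applying `gegenbauer_neg` at `-1` gives `G(-1)² = 1`, without
computing `G(-1)`. -/
theorem gegenbauer_neg_sq (n d : ℕ) (hd : 1 ≤ d) (t : ℝ) :
    gegenbauer n d (-t) ^ 2 = gegenbauer n d t ^ 2 := by
  have h := gegenbauer_neg n d hd (-1)
  rw [neg_neg, gegenbauer_one n d hd] at h
  rw [gegenbauer_neg n d hd t]
  linear_combination -(gegenbauer n d t) ^ 2 * h

/-! ### Pointwise bounds from energy and Sonin functions. -/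

/-- The derivative of the Gegenbauer polynomial. -/
noncomputable def gegenbauerDeriv (n d : ℕ) (t : ℝ) : ℝ :=
  (derivative (shiftedGegenbauer n d)).eval ((t - 1) / 2) / 2

/-- The second derivative of the Gegenbauer polynomial. -/
noncomputable def gegenbauerDeriv₂ (n d : ℕ) (t : ℝ) : ℝ :=
  (derivative (derivative (shiftedGegenbauer n d))).eval ((t - 1) / 2) / 4

theorem hasDerivAt_eval_half (p : ℝ[X]) (t : ℝ) :
    HasDerivAt (fun t : ℝ => p.eval ((t - 1) / 2)) ((derivative p).eval ((t - 1) / 2) / 2) t := by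
  have h := (p.hasDerivAt ((t - 1) / 2)).comp t (((hasDerivAt_id t).sub_const 1).div_const 2)
  exact h.congr_deriv (by simp [div_eq_mul_inv])

theorem hasDerivAt_gegenbauer (n d : ℕ) (t : ℝ) :
    HasDerivAt (gegenbauer n d) (gegenbauerDeriv n d t) t := by
  rw [show gegenbauer n d = fun t => (shiftedGegenbauer n d).eval ((t - 1) / 2) from
    funext (gegenbauer_eq_eval n d)]
  exact hasDerivAt_eval_half _ t

theorem hasDerivAt_gegenbauerDeriv (n d : ℕ) (t : ℝ) :
    HasDerivAt (gegenbauerDeriv n d) (gegenbauerDeriv₂ n d t) t := by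
  have h := (hasDerivAt_eval_half (derivative (shiftedGegenbauer n d)) t).div_const 2
  exact h.congr_deriv (by unfold gegenbauerDeriv₂; ring)

theorem gegenbauer_ode (n d : ℕ) (t : ℝ) :
    (1 - t ^ 2) * gegenbauerDeriv₂ n d t =
      d * t * gegenbauerDeriv n d t - n * (n + d - 1) * gegenbauer n d t := by
  have h := congrArg (fun r => r.eval ((t - 1) / 2)) (isGegenbauerSolution_shiftedGegenbauer n d)
  simp only [eval_add, eval_mul, eval_C, eval_X, eval_one] at h
  rw [show eval ((t - 1) / 2) (2 : ℝ[X]) = 2 from eval_ofNat _ _] at h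
  rw [gegenbauer_eq_eval, gegenbauerDeriv, gegenbauerDeriv₂]
  linear_combination -h

theorem continuous_gegenbauer (n d : ℕ) : Continuous (gegenbauer n d) :=
  continuous_iff_continuousAt.2 fun t => (hasDerivAt_gegenbauer n d t).continuousAt

theorem monotoneOn_Icc_of_hasDerivAt_nonneg {f f' : ℝ → ℝ} {a b : ℝ}
    (hc : ∀ t ∈ Set.Icc a b, ContinuousAt f t)
    (h : ∀ t ∈ Set.Ioo a b, HasDerivAt f (f' t) t) (h0 : ∀ t ∈ Set.Ioo a b, 0 ≤ f' t) :
    MonotoneOn f (Set.Icc a b) := by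
  refine monotoneOn_of_deriv_nonneg (convex_Icc a b)
    (fun t ht => (hc t ht).continuousWithinAt) ?_ ?_ <;> rw [interior_Icc] <;> intro t ht
  · exact (h t ht).differentiableAt.differentiableWithinAt
  · rw [(h t ht).deriv]
    exact h0 t ht

/-- By the differential equation the left side has derivative `2 (d - 1) t G'² / (n (n + d - 1))`,
so it increases on `[0, 1]` to its value at `t = 1`, where the second term vanishes and `G = 1`. -/
theorem gegenbauer_energy_le_one {n d : ℕ} (hn : 1 ≤ n) (hd : 3 ≤ d) {t : ℝ} (h0 : 0 ≤ t)
    (h1 : t ≤ 1) :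
    gegenbauer n d t ^ 2 + (1 - t ^ 2) * gegenbauerDeriv n d t ^ 2 / (n * (n + d - 1)) ≤ 1 := by
  have hn' : (1 : ℝ) ≤ n := by exact_mod_cast hn
  have hd' : (3 : ℝ) ≤ d := by exact_mod_cast hd
  have hl : (0 : ℝ) < n * (n + d - 1) := mul_pos (by linarith) (by linarith)
  obtain ⟨lam, hlam⟩ : ∃ lam : ℝ, lam = n * (n + d - 1) := ⟨_, rfl⟩
  rw [← hlam] at hl ⊢
  have hder : ∀ u : ℝ, HasDerivAt
      (fun t => gegenbauer n d t ^ 2 + (1 - t ^ 2) * gegenbauerDeriv n d t ^ 2 / lam)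
      (2 * (d - 1) * u * gegenbauerDeriv n d u ^ 2 / lam) u := by
    intro u
    have hG := hasDerivAt_gegenbauer n d u
    have hG' := hasDerivAt_gegenbauerDeriv n d u
    have h := (hG.pow 2).add
      ((((hasDerivAt_id u).pow 2).const_sub 1 |>.mul (hG'.pow 2)).div_const lam)
    refine h.congr_deriv ?_
    have hode := gegenbauer_ode n d u
    rw [← hlam] at hode
    simp only [id, Nat.cast_ofNat, Pi.pow_apply]
    field_simp
    linear_combination gegenbauerDeriv n d u * hode
  have hm := monotoneOn_Icc_of_hasDerivAt_nonneg (a := 0) (b := 1)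
    (fun u _ => (hder u).continuousAt) (fun u _ => hder u) (fun u hu => by
      have := hu.1.le
      have : (0 : ℝ) ≤ d - 1 := by linarith
      positivity)
  have h := hm ⟨h0, h1⟩ ⟨zero_le_one, le_rfl⟩ h1
  simpa [gegenbauer_one n d (by omega)] using h

theorem abs_gegenbauer_le_one {n d : ℕ} (hn : 1 ≤ n) (hd : 3 ≤ d) {t : ℝ} (h : |t| ≤ 1) :
    |gegenbauer n d t| ≤ 1 := by
  have key : ∀ u : ℝ, 0 ≤ u → u ≤ 1 → gegenbauer n d u ^ 2 ≤ 1 := by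
    intro u h0 h1
    refine le_trans (le_add_of_nonneg_right ?_) (gegenbauer_energy_le_one hn hd h0 h1)
    have : (0 : ℝ) ≤ 1 - u ^ 2 := by nlinarith
    have hn' : (1 : ℝ) ≤ n := by exact_mod_cast hn
    have hd' : (3 : ℝ) ≤ d := by exact_mod_cast hd
    have : (0 : ℝ) ≤ n + d - 1 := by linarith
    positivity
  rw [← sq_le_one_iff_abs_le_one]
  rcases le_total 0 t with h0 | h0
  · exact key t h0 (abs_le.1 h).2
  · rw [← gegenbauer_neg_sq n d (by omega)]
    exact key (-t) (by linarith) (by linarith [(abs_le.1 h).1])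

/-- The Sonin function of `(1 - t²) ^ (a / 2) * G(t)` with respect to the angle is monotone. -/
theorem monotoneOn_gegenbauer_sonin {n d : ℕ} (hd : 3 ≤ d) {a N t₀ : ℝ}
    (ha : a = ((d : ℝ) - 1) / 2) (hN : N = n + a) (h1 : t₀ < 1)
    (hD : ∀ t, 0 ≤ t → t ≤ t₀ → 0 < N ^ 2 * (1 - t ^ 2) - a * (a - 1)) :
    MonotoneOn (fun t => (1 - t ^ 2) ^ a * (gegenbauer n d t ^ 2 +
      (a * t * gegenbauer n d t - (1 - t ^ 2) * gegenbauerDeriv n d t) ^ 2 /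
        (N ^ 2 * (1 - t ^ 2) - a * (a - 1)))) (Set.Icc 0 t₀) := by
  have hd' : (3 : ℝ) ≤ d := by exact_mod_cast hd
  -- The function `w(θ) = sin^a θ · G(cos θ)` solves `w'' + Q w = 0` with `Q = N² - a(a-1)/sin² θ`,
  -- and the function at hand is `w² + w'²/Q`. Its `θ`-derivative is `-w'² Q'/Q²`, and `Q' ≥ 0` for
  -- `cos θ ≥ 0`, so it increases in `t`.
  have hder : ∀ u ∈ Set.Icc 0 t₀, HasDerivAt
      (fun t => (1 - t ^ 2) ^ a * (gegenbauer n d t ^ 2 +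
      (a * t * gegenbauer n d t - (1 - t ^ 2) * gegenbauerDeriv n d t) ^ 2 /
        (N ^ 2 * (1 - t ^ 2) - a * (a - 1))))
      ((1 - u ^ 2) ^ (a - 1) * (2 * u * (a * (a - 1)) *
        (a * u * gegenbauer n d u - (1 - u ^ 2) * gegenbauerDeriv n d u) ^ 2 /
        (N ^ 2 * (1 - u ^ 2) - a * (a - 1)) ^ 2)) u := by
    intro u hu
    have hs : 0 < 1 - u ^ 2 := by nlinarith [hu.1, hu.2]
    have hDu := hD u hu.1 hu.2
    have hG := hasDerivAt_gegenbauer n d u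
    have hG' := hasDerivAt_gegenbauerDeriv n d u
    have hS : HasDerivAt (fun t : ℝ => 1 - t ^ 2) (-(2 * u)) u := by
      simpa using (hasDerivAt_pow 2 u).const_sub 1
    have hSa := hS.rpow_const (p := a) (Or.inl hs.ne')
    have hW : HasDerivAt (fun t => a * t * gegenbauer n d t - (1 - t ^ 2) * gegenbauerDeriv n d t)
        (a * gegenbauer n d u + a * u * gegenbauerDeriv n d u -
          (-(2 * u) * gegenbauerDeriv n d u + (1 - u ^ 2) * gegenbauerDeriv₂ n d u)) u := by
      exact ((((hasDerivAt_id u).const_mul a).mul hG).sub (hS.mul hG')).congr_deriv (by simp)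
    have hDD : HasDerivAt (fun t : ℝ => N ^ 2 * (1 - t ^ 2) - a * (a - 1))
        (N ^ 2 * -(2 * u)) u := (hS.const_mul (N ^ 2)).sub_const _
    have h := hSa.mul ((hG.pow 2).add ((hW.pow 2).div hDD hDu.ne'))
    refine h.congr_deriv ?_
    have hode := gegenbauer_ode n d u
    simp only [Nat.cast_ofNat, Pi.pow_apply, Pi.add_apply, Pi.div_apply]
    have hpow : (1 - u ^ 2) ^ a = (1 - u ^ 2) ^ (a - 1) * (1 - u ^ 2) := by
      rw [Real.rpow_sub_one hs.ne', div_mul_cancel₀ _ hs.ne']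
    rw [hpow]
    have hdd : (d : ℝ) = 2 * a + 1 := by linarith
    have hnn : (n : ℝ) = N - a := by linarith
    rw [hdd, hnn] at hode
    obtain ⟨D, hDe⟩ : ∃ D, D = N ^ 2 * (1 - u ^ 2) - a * (a - 1) := ⟨_, rfl⟩
    obtain ⟨W, hWe⟩ : ∃ W, W = a * u * gegenbauer n d u -
      (1 - u ^ 2) * gegenbauerDeriv n d u := ⟨_, rfl⟩
    obtain ⟨W', hWe'⟩ : ∃ W', W' = a * gegenbauer n d u + a * u * gegenbauerDeriv n d u -
      (-(2 * u) * gegenbauerDeriv n d u + (1 - u ^ 2) * gegenbauerDeriv₂ n d u) := ⟨_, rfl⟩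
    -- These identities eliminate `G'` and `G''`; the `G²` and `G W` terms then cancel, and only the
    -- multiple `a(a-1)` of `W²/D²` survives.
    have e1 : (1 - u ^ 2) * gegenbauerDeriv n d u = a * u * gegenbauer n d u - W := by
      rw [hWe]; ring
    have e2 : (1 - u ^ 2) * W' = D * gegenbauer n d u - (1 - a) * u * W := by
      rw [hWe', hDe, hWe, hode]; ring
    have e3 : N ^ 2 * (1 - u ^ 2) = D + a * (a - 1) := by rw [hDe]; ring
    rw [← hWe', ← hDe, ← hWe]
    rw [← hDe] at hDu
    generalize (1 - u ^ 2) ^ (a - 1) = R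
    generalize gegenbauer n d u = G at *
    generalize gegenbauerDeriv n d u = G' at *
    trans R * (-2 * u * a * (G ^ 2 + W ^ 2 / D) + 2 * G * ((1 - u ^ 2) * G') +
      (2 * W * ((1 - u ^ 2) * W') * D + W ^ 2 * (2 * u) * (N ^ 2 * (1 - u ^ 2))) / D ^ 2)
    · ring
    · rw [e1, e2, e3]
      field_simp
      ring
  refine monotoneOn_Icc_of_hasDerivAt_nonneg (fun u hu => (hder u hu).continuousAt)
    (fun u hu => hder u ⟨hu.1.le, hu.2.le⟩) fun u hu => ?_
  have hs : 0 < 1 - u ^ 2 := by nlinarith [hu.1, hu.2]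
  have : 0 ≤ a - 1 := by linarith
  have : 0 ≤ a := by linarith
  have := hu.1.le
  positivity

/-- The Bernstein-type bound `|G(cos θ)|² ≤ C (ℓ sin θ)^{-(d-1)}`. -/
theorem exists_gegenbauer_bound (d : ℕ) (hd : 3 ≤ d) :
    ∃ C : ℝ, 0 < C ∧ ∀ n : ℕ, 1 ≤ n → ∀ t : ℝ, |t| ≤ 1 →
      (n * √(1 - t ^ 2)) ^ (d - 1) * gegenbauer n d t ^ 2 ≤ C := by
  have hd' : (3 : ℝ) ≤ d := by exact_mod_cast hd
  obtain ⟨a, ha⟩ : ∃ a : ℝ, a = ((d : ℝ) - 1) / 2 := ⟨_, rfl⟩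
  have ha1 : 1 ≤ a := by linarith
  -- `K` exceeds `a(a-1)` by a margin, so the Sonin denominator stays away from `0` where `N² sin² θ
  -- ≥ K`.
  obtain ⟨K, hK⟩ : ∃ K : ℝ, K = 2 * (a * (a - 1)) + 1 := ⟨_, rfl⟩
  have hb : 0 ≤ a * (a - 1) := mul_nonneg (by linarith) (by linarith)
  have hK1 : 1 ≤ K := by linarith
  have key : ∀ n : ℕ, 1 ≤ n → ∀ t : ℝ, 0 ≤ t → t ≤ 1 →
      ((n : ℝ) ^ 2 * (1 - t ^ 2)) ^ a * gegenbauer n d t ^ 2 ≤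
        K ^ a * (1 + 4 * (a ^ 2 + K)) := by
    intro n hn t h0 h1
    have hn' : (1 : ℝ) ≤ n := by exact_mod_cast hn
    obtain ⟨N, hN⟩ : ∃ N : ℝ, N = n + a := ⟨_, rfl⟩
    have hNpos : 0 < N := by linarith
    have hs : 0 ≤ 1 - t ^ 2 := by nlinarith
    have hG1 : ∀ u : ℝ, 0 ≤ u → u ≤ 1 → gegenbauer n d u ^ 2 ≤ 1 := fun u h0 h1 =>
      (sq_le_one_iff_abs_le_one _).2 (abs_gegenbauer_le_one hn hd (abs_le.2 ⟨by linarith, h1⟩))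
    have hKa : 0 ≤ K ^ a := by positivity
    refine le_trans (b := (N ^ 2 * (1 - t ^ 2)) ^ a * gegenbauer n d t ^ 2) ?_ ?_
    · have : (n : ℝ) ^ 2 ≤ N ^ 2 := by
        apply pow_le_pow_left₀ (by linarith)
        linarith
      gcongr
    -- Within angle of order `1/N` of the pole `|G| ≤ 1` suffices. Farther away, monotonicity
    -- compares `t` with the transition point `v`, where `N² (1 - v²) = K`.
    rcases le_or_gt (N ^ 2 * (1 - t ^ 2)) K with hle | hgt
    · calc (N ^ 2 * (1 - t ^ 2)) ^ a * gegenbauer n d t ^ 2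
          ≤ K ^ a * 1 := by
            gcongr
            exact hG1 t h0 h1
        _ ≤ _ := by
            gcongr
            nlinarith
    · obtain ⟨s, hsdef⟩ : ∃ s : ℝ, s = K / N ^ 2 := ⟨_, rfl⟩
      have hNs : N ^ 2 * s = K := by rw [hsdef]; field_simp
      have hspos : 0 < s := by rw [hsdef]; positivity
      have hst : s < 1 - t ^ 2 := by
        rw [← hNs] at hgt
        exact lt_of_mul_lt_mul_left hgt (by positivity)
      have hs1 : s ≤ 1 := by nlinarith
      obtain ⟨v, hv⟩ : ∃ v : ℝ, v = √(1 - s) := ⟨_, rfl⟩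
      have hv0 : 0 ≤ v := hv ▸ Real.sqrt_nonneg _
      have hv2 : v ^ 2 = 1 - s := by rw [hv, Real.sq_sqrt (by linarith)]
      have hv1 : v < 1 := by nlinarith
      have htv : t ≤ v := by
        rw [hv]
        exact Real.le_sqrt_of_sq_le (by linarith)
      have hmono := monotoneOn_gegenbauer_sonin hd ha hN hv1 (fun u hu0 huv => by
        have : u ^ 2 ≤ v ^ 2 := pow_le_pow_left₀ hu0 huv 2
        have : N ^ 2 * s ≤ N ^ 2 * (1 - u ^ 2) := by
          gcongr
          linarith
        linarith)
      have h := hmono ⟨h0, htv⟩ ⟨hv0, le_rfl⟩ htv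
      simp only [show 1 - v ^ 2 = s by linarith, hNs] at h
      have hD : 0 < N ^ 2 * (1 - t ^ 2) - a * (a - 1) := by linarith
      have hDK : 1 / 2 ≤ K - a * (a - 1) := by linarith
      -- The energy bound at `v` controls `G'`, since `n (n + d - 1) = N² - a² ≤ N²`.
      have hsG : s * gegenbauerDeriv n d v ^ 2 ≤ N ^ 2 := by
        have hF := gegenbauer_energy_le_one hn hd hv0 hv1.le
        have hl : (n : ℝ) * (n + d - 1) = N ^ 2 - a ^ 2 := by
          rw [hN, show (d : ℝ) = 2 * a + 1 by linarith]; ring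
        have hlpos : (0 : ℝ) < n * (n + d - 1) := mul_pos (by linarith) (by linarith)
        have h2 : (1 - v ^ 2) * gegenbauerDeriv n d v ^ 2 / (n * (n + d - 1)) ≤ 1 := by
          linarith [sq_nonneg (gegenbauer n d v)]
        rw [div_le_one hlpos, hl, show 1 - v ^ 2 = s by linarith] at h2
        linarith [sq_nonneg a]
      have hW : (a * v * gegenbauer n d v - s * gegenbauerDeriv n d v) ^ 2 ≤ 2 * (a ^ 2 + K) := by
        have h3 : (a * v * gegenbauer n d v) ^ 2 ≤ a ^ 2 := by
          rw [mul_pow, mul_pow, mul_assoc]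
          refine mul_le_of_le_one_right (sq_nonneg a)
            (mul_le_one₀ (by linarith) (sq_nonneg _) (hG1 v hv0 hv1.le))
        have h4 : (s * gegenbauerDeriv n d v) ^ 2 ≤ K := by
          have := mul_le_mul_of_nonneg_left hsG hspos.le
          linarith
        nlinarith [sq_nonneg (a * v * gegenbauer n d v + s * gegenbauerDeriv n d v)]
      have hR : gegenbauer n d v ^ 2 +
          (a * v * gegenbauer n d v - s * gegenbauerDeriv n d v) ^ 2 / (K - a * (a - 1)) ≤
          1 + 4 * (a ^ 2 + K) := by
        refine add_le_add (hG1 v hv0 hv1.le) ?_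
        rw [div_le_iff₀ (by linarith)]
        have : 0 ≤ a ^ 2 + K := by positivity
        nlinarith
      have hL : (1 - t ^ 2) ^ a * gegenbauer n d t ^ 2 ≤ s ^ a * (1 + 4 * (a ^ 2 + K)) := by
        refine le_trans ?_ (h.trans ?_)
        · gcongr
          exact le_add_of_nonneg_right (by positivity)
        · gcongr
      rw [Real.mul_rpow (by positivity) hs, ← hNs, Real.mul_rpow (by positivity) hspos.le,
        mul_assoc, mul_assoc, hNs]
      gcongr
  refine ⟨K ^ a * (1 + 4 * (a ^ 2 + K)), by positivity, fun n hn t ht => ?_⟩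
  have hconv : ∀ u : ℝ, |u| ≤ 1 →
      (n * √(1 - u ^ 2)) ^ (d - 1) = ((n : ℝ) ^ 2 * (1 - u ^ 2)) ^ a := by
    intro u hu
    have hs : 0 ≤ 1 - u ^ 2 := by
      have := (sq_le_one_iff_abs_le_one u).2 hu
      linarith
    have h2 : (n : ℝ) ^ 2 * (1 - u ^ 2) = (n * √(1 - u ^ 2)) ^ 2 := by
      rw [mul_pow, Real.sq_sqrt hs]
    rw [h2, ← Real.rpow_natCast (_ * _) 2, ← Real.rpow_mul (by positivity), ← Real.rpow_natCast,
      Nat.cast_sub (by omega), ha]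
    congr 1
    push_cast
    ring
  rw [hconv t ht]
  rcases le_total 0 t with h0 | h0
  · exact key n hn t h0 (abs_le.1 ht).2
  · have := key n hn (-t) (by linarith) (by linarith [(abs_le.1 ht).1])
    rwa [gegenbauer_neg_sq n d (by omega), neg_sq] at this

/-! ### Measure of polar neighbourhoods and dyadic integration. -/

/-- The sine of the angle between two points of the sphere. -/
noncomputable def sphericalSin {d : ℕ} (x y : UnitSphere d) : ℝ :=
  √(1 - inner ℝ (x : EuclideanSpace ℝ (Fin (d + 1))) (y : EuclideanSpace ℝ (Fin (d + 1))) ^ 2)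

theorem continuous_sphericalSin {d : ℕ} (x : UnitSphere d) : Continuous (sphericalSin x) := by
  unfold sphericalSin
  fun_prop

open scoped Pointwise in
-- The measure is `d + 1` times the volume of the cone over the set. In an orthonormal basis
-- starting with `x`, that cone lies in the box `[-1, 1] × [-s, s]^d`.
theorem surfaceMeasure_sphericalSin_lt_le {d : ℕ} (x : UnitSphere d) (s : ℝ) :
    surfaceMeasure d {y | sphericalSin x y < s} ≤
      (d + 1 : ℕ) * (ENNReal.ofReal 2 * ENNReal.ofReal (2 * s) ^ d) := by
  have hx : ‖(x : EuclideanSpace ℝ (Fin (d + 1)))‖ = 1 := by simp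
  obtain ⟨b, hb⟩ := Orthonormal.exists_orthonormalBasis_extension_of_card_eq (𝕜 := ℝ)
    (E := EuclideanSpace ℝ (Fin (d + 1))) (ι := Fin (d + 1)) (by simp)
    (v := fun _ => (x : EuclideanSpace ℝ (Fin (d + 1)))) (s := {0}) (by
      constructor
      · intro i
        simp
      · intro i j hij
        exact absurd (Subsingleton.elim i j) hij)
  have hb0 : b 0 = x := hb 0 rfl
  have hmeas : MeasurableSet {y | sphericalSin x y < s} :=
    (isOpen_lt (continuous_sphericalSin x) continuous_const).measurableSet
  rw [surfaceMeasure, Measure.toSphere_apply' _ hmeas, finrank_euclideanSpace_fin]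
  gcongr
  set lo : Fin (d + 1) → ℝ := Fin.cons (-1) fun _ => -s
  set hi : Fin (d + 1) → ℝ := Fin.cons 1 fun _ => s
  have hsub : Set.Ioo (0 : ℝ) 1 • (Subtype.val '' {y | sphericalSin x y < s}) ⊆
      (fun z => WithLp.ofLp (b.repr z)) ⁻¹' Set.Icc lo hi := by
    rintro _ ⟨r, hr, _, ⟨y, hy, rfl⟩, rfl⟩
    have hy1 : ‖(y : EuclideanSpace ℝ (Fin (d + 1)))‖ = 1 := by simp
    have hsum := b.sum_sq_norm_inner_right (y : EuclideanSpace ℝ (Fin (d + 1)))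
    rw [hy1, Fin.sum_univ_succ, hb0] at hsum
    simp only [Real.norm_eq_abs, sq_abs, one_pow] at hsum
    have hi0 : |inner ℝ (x : EuclideanSpace ℝ (Fin (d + 1))) (y : EuclideanSpace ℝ (Fin (d + 1)))|
        ≤ 1 := by
      simpa [hx, hy1] using abs_real_inner_le_norm (x : EuclideanSpace ℝ (Fin (d + 1))) y
    have hi' : ∀ i : Fin d,
        |inner ℝ (b i.succ) (y : EuclideanSpace ℝ (Fin (d + 1)))| ≤ s := by
      intro i
      refine le_trans ?_ (le_of_lt hy)
      refine Real.abs_le_sqrt ?_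
      have := Finset.single_le_sum
        (f := fun i : Fin d => inner ℝ (b i.succ) (y : EuclideanSpace ℝ (Fin (d + 1))) ^ 2)
        (fun j _ => sq_nonneg _) (Finset.mem_univ i)
      linarith
    have hmul : ∀ v M : ℝ, |v| ≤ M → -M ≤ r * v ∧ r * v ≤ M := by
      intro v M hv
      rw [← abs_le, abs_mul, abs_of_pos hr.1]
      exact (mul_le_of_le_one_left (abs_nonneg _) hr.2.le).trans hv
    have hrepr : ∀ i, WithLp.ofLp (b.repr (r • (y : EuclideanSpace ℝ (Fin (d + 1))))) i =
        r * inner ℝ (b i) (y : EuclideanSpace ℝ (Fin (d + 1))) := by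
      intro i
      rw [b.repr_apply_apply, inner_smul_right]
    simp only [Set.mem_preimage, Set.mem_Icc, Pi.le_def]
    refine ⟨fun i => ?_, fun i => ?_⟩ <;> refine Fin.cases ?_ (fun i => ?_) i <;>
      simp only [hrepr, lo, hi, Fin.cons_zero, Fin.cons_succ, hb0]
    · exact (hmul _ _ hi0).1
    · exact (hmul _ _ (hi' i)).1
    · exact (hmul _ _ hi0).2
    · exact (hmul _ _ (hi' i)).2
  have hmp : MeasurePreserving (fun z => WithLp.ofLp (b.repr z)) :=
    (PiLp.volume_preserving_ofLp _).comp b.measurePreserving_repr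
  refine (measure_mono hsub).trans (le_of_eq ?_)
  rw [hmp.measure_preimage measurableSet_Icc.nullMeasurableSet, Real.volume_Icc_pi,
    Fin.prod_univ_succ]
  simp only [lo, hi, Fin.cons_zero, Fin.cons_succ, Finset.prod_const, Finset.card_univ,
    Fintype.card_fin]
  congr 3 <;> ring_nf

/-- A dyadic decomposition of the integral of a function decaying like `(n sin θ)^{-p}`. -/
theorem lintegral_le_of_sphericalSin_decay {d n p : ℕ} (hn : 1 ≤ n) (x : UnitSphere d)
    (f : UnitSphere d → ℝ) {B : ℝ} (hB : 0 ≤ B) (h1 : ∀ y, f y ≤ B)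
    (h2 : ∀ y, (n * sphericalSin x y) ^ p * f y ≤ B) :
    ∫⁻ y, ENNReal.ofReal (f y) ∂surfaceMeasure d ≤
      ENNReal.ofReal ((d + 1) * 2 * 4 ^ d * B / n ^ d *
        ∑ k ∈ Finset.range (Nat.log 2 n + 1), (2 : ℝ) ^ (d * k) / 2 ^ (p * k)) := by
  have hn' : (0 : ℝ) < n := by exact_mod_cast hn
  set E : ℕ → Set (UnitSphere d) := fun k => {y | sphericalSin x y < 2 ^ (k + 1) / n}
  have hE : ∀ k, MeasurableSet (E k) := fun k =>
    (isOpen_lt (continuous_sphericalSin x) continuous_const).measurableSet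
  have hpt : ∀ y, ENNReal.ofReal (f y) ≤ ∑ k ∈ Finset.range (Nat.log 2 n + 1),
      (E k).indicator (fun _ => ENNReal.ofReal (B / 2 ^ (p * k))) y := by
    intro y
    have hw0 : 0 ≤ n * sphericalSin x y := mul_nonneg hn'.le (Real.sqrt_nonneg _)
    have hw1 : n * sphericalSin x y ≤ n := by
      refine mul_le_of_le_one_right hn'.le ?_
      rw [sphericalSin, Real.sqrt_le_one]
      linarith [sq_nonneg
        (inner ℝ (x : EuclideanSpace ℝ (Fin (d + 1))) (y : EuclideanSpace ℝ (Fin (d + 1))))]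
    have hex : ∃ k, n * sphericalSin x y < 2 ^ (k + 1) := by
      refine ⟨Nat.log 2 n, hw1.trans_lt ?_⟩
      exact_mod_cast Nat.lt_pow_succ_log_self one_lt_two n
    classical
    -- The sets `E k` are nested; each `y` is charged to the first one containing it. Minimality
    -- gives `2^k ≤ n sin θ` when `k ≥ 1`, while `k = 0` uses only `f ≤ B`.
    obtain ⟨k, hk, hmin⟩ : ∃ k, n * sphericalSin x y < 2 ^ (k + 1) ∧
        ∀ j, n * sphericalSin x y < 2 ^ (j + 1) → k ≤ j :=
      ⟨Nat.find hex, Nat.find_spec hex, fun j hj => Nat.find_min' hex hj⟩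
    have hkL : k ≤ Nat.log 2 n := hmin _ (hw1.trans_lt
      (by exact_mod_cast Nat.lt_pow_succ_log_self one_lt_two n))
    refine le_trans ?_ (Finset.single_le_sum (f := fun k => (E k).indicator
      (fun _ => ENNReal.ofReal (B / 2 ^ (p * k))) y) (fun _ _ => zero_le)
      (Finset.mem_range.2 (Nat.lt_succ_of_le hkL)))
    have hyE : y ∈ E k := by
      simp only [E, Set.mem_ofPred_eq]
      rw [lt_div_iff₀ hn', mul_comm]
      exact hk
    simp only [Set.indicator_of_mem hyE]
    refine ENNReal.ofReal_le_ofReal ?_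
    rcases k with _ | k
    · simpa using h1 y
    · have hlow : (2 : ℝ) ^ (k + 1) ≤ n * sphericalSin x y := by
        by_contra hcon
        exact absurd (hmin k (not_le.1 hcon)) (by omega)
      rw [le_div_iff₀ (by positivity), mul_comm p, pow_mul]
      rcases le_or_gt (f y) 0 with hf | hf
      · exact (mul_nonpos_of_nonpos_of_nonneg hf (by positivity)).trans hB
      · refine le_trans ?_ (h2 y)
        rw [mul_comm]
        gcongr
  calc ∫⁻ y, ENNReal.ofReal (f y) ∂surfaceMeasure d
      ≤ ∫⁻ y, ∑ k ∈ Finset.range (Nat.log 2 n + 1),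
          (E k).indicator (fun _ => ENNReal.ofReal (B / 2 ^ (p * k))) y ∂surfaceMeasure d :=
        lintegral_mono hpt
    _ = ∑ k ∈ Finset.range (Nat.log 2 n + 1),
          ENNReal.ofReal (B / 2 ^ (p * k)) * surfaceMeasure d (E k) := by
        rw [lintegral_finsetSum _ fun k _ => measurable_const.indicator (hE k)]
        exact Finset.sum_congr rfl fun k _ => lintegral_indicator_const (hE k) _
    _ ≤ ∑ k ∈ Finset.range (Nat.log 2 n + 1), ENNReal.ofReal ((d + 1) * 2 * 4 ^ d * B / n ^ d *
          ((2 : ℝ) ^ (d * k) / 2 ^ (p * k))) := by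
        refine Finset.sum_le_sum fun k _ => ?_
        refine (mul_le_mul_right (surfaceMeasure_sphericalSin_lt_le x _) _).trans (le_of_eq ?_)
        rw [← ENNReal.ofReal_natCast (d + 1), ← ENNReal.ofReal_pow (by positivity),
          ← ENNReal.ofReal_mul (by positivity), ← ENNReal.ofReal_mul (by positivity),
          ← ENNReal.ofReal_mul (by positivity)]
        congr 1
        have : (2 * ((2 : ℝ) ^ (k + 1) / n)) ^ d = 4 ^ d * 2 ^ (d * k) / n ^ d := by
          rw [show 2 * ((2 : ℝ) ^ (k + 1) / n) = 4 * 2 ^ k / n by ring, div_pow, mul_pow,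
            ← pow_mul, mul_comm k]
        rw [this]
        push_cast
        ring
    _ = _ := by
        rw [Finset.mul_sum, ENNReal.ofReal_sum_of_nonneg fun k _ => by positivity]

/-! ### Second and fourth moments of the kernel. -/

theorem gegenbauerKernel_eq {d : ℕ} (n : ℕ) (x y : UnitSphere d) :
    gegenbauerKernel n d x y = gegenbauer n d
      (inner ℝ (x : EuclideanSpace ℝ (Fin (d + 1))) (y : EuclideanSpace ℝ (Fin (d + 1)))) := by
  simp [gegenbauerKernel, sphericalDist, InnerProductGeometry.cos_angle]

theorem gegenbauerKernel_comm {d : ℕ} (n : ℕ) (x y : UnitSphere d) :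
    gegenbauerKernel n d x y = gegenbauerKernel n d y x := by
  rw [gegenbauerKernel_eq, gegenbauerKernel_eq, real_inner_comm]

theorem continuous_gegenbauerKernel (n d : ℕ) :
    Continuous fun p : UnitSphere d × UnitSphere d => gegenbauerKernel n d p.1 p.2 := by
  simp only [gegenbauerKernel_eq]
  exact (continuous_gegenbauer n d).comp (by fun_prop)

theorem abs_inner_unitSphere_le_one {d : ℕ} (x y : UnitSphere d) :
    |inner ℝ (x : EuclideanSpace ℝ (Fin (d + 1))) (y : EuclideanSpace ℝ (Fin (d + 1)))| ≤ 1 := by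
  simpa using abs_real_inner_le_norm (x : EuclideanSpace ℝ (Fin (d + 1))) y

theorem abs_gegenbauerKernel_le_one {d n : ℕ} (hn : 1 ≤ n) (hd : 3 ≤ d) (x y : UnitSphere d) :
    |gegenbauerKernel n d x y| ≤ 1 := by
  rw [gegenbauerKernel_eq]
  exact abs_gegenbauer_le_one hn hd (abs_inner_unitSphere_le_one x y)

theorem sum_two_pow_le (m : ℕ) : ∑ k ∈ Finset.range (m + 1), (2 : ℝ) ^ k ≤ 2 * 2 ^ m := by
  rw [geom_sum_eq (by norm_num)]
  rw [pow_succ]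
  norm_num
  linarith

theorem sum_inv_two_pow_le (m : ℕ) : ∑ k ∈ Finset.range m, ((2 : ℝ) ^ k)⁻¹ ≤ 2 := by
  simp only [← inv_pow]
  rw [geom_sum_eq (by norm_num)]
  have : (0 : ℝ) ≤ 2⁻¹ ^ m := by positivity
  rw [div_le_iff_of_neg (by norm_num)]
  linarith

/-- Scale `k` contributes `2^{dk} / 2^{(d-1)k} = 2^k`, so the largest scale dominates and costs the
extra factor `n`. -/
theorem exists_lintegral_gegenbauerKernel_sq_le (d : ℕ) (hd : 3 ≤ d) :
    ∃ C : ℝ, 0 < C ∧ ∀ n : ℕ, 1 ≤ n → ∀ x : UnitSphere d,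
      ∫⁻ y, ENNReal.ofReal (|gegenbauerKernel n d x y| ^ 2) ∂surfaceMeasure d ≤
        ENNReal.ofReal (C * n / n ^ d) := by
  obtain ⟨B, hB, h⟩ := exists_gegenbauer_bound d hd
  refine ⟨(d + 1) * 2 * 4 ^ d * (B + 1) * 2, by positivity, fun n hn x => ?_⟩
  refine (lintegral_le_of_sphericalSin_decay (p := d - 1) (B := B + 1) hn x _ (by linarith)
    (fun y => ?_) fun y => ?_).trans (ENNReal.ofReal_le_ofReal ?_)
  · exact (pow_le_one₀ (abs_nonneg _) (abs_gegenbauerKernel_le_one hn hd x y)).trans (by linarith)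
  · rw [sq_abs, gegenbauerKernel_eq, sphericalSin]
    exact (h n hn _ (abs_inner_unitSphere_le_one x y)).trans (by linarith)
  · have hs : ∑ k ∈ Finset.range (Nat.log 2 n + 1), (2 : ℝ) ^ (d * k) / 2 ^ ((d - 1) * k) ≤
        2 * n := by
      calc _ = ∑ k ∈ Finset.range (Nat.log 2 n + 1), (2 : ℝ) ^ k := by
            refine Finset.sum_congr rfl fun k _ => ?_
            rw [div_eq_iff (by positivity), ← pow_add]
            congr 1
            obtain ⟨e, rfl⟩ : ∃ e, d = e + 1 := ⟨d - 1, by omega⟩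
            rw [Nat.add_sub_cancel]
            ring
        _ ≤ 2 * 2 ^ Nat.log 2 n := sum_two_pow_le _
        _ ≤ 2 * n := by
            gcongr
            exact_mod_cast Nat.pow_log_le_self 2 (by omega)
    have hn' : (0 : ℝ) < n := by exact_mod_cast hn
    calc _ ≤ (d + 1) * 2 * 4 ^ d * (B + 1) / n ^ d * (2 * n) := by gcongr
      _ = _ := by ring

/-- Scale `k` contributes `2^{-(d-2)k}`, which is summable because `d ≥ 3`; angles of order `1/n`
dominate. -/
theorem exists_lintegral_gegenbauerKernel_pow_four_le (d : ℕ) (hd : 3 ≤ d) :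
    ∃ C : ℝ, 0 < C ∧ ∀ n : ℕ, 1 ≤ n → ∀ x : UnitSphere d,
      ∫⁻ y, ENNReal.ofReal (|gegenbauerKernel n d x y| ^ 4) ∂surfaceMeasure d ≤
        ENNReal.ofReal (C / n ^ d) := by
  obtain ⟨B, hB, h⟩ := exists_gegenbauer_bound d hd
  refine ⟨(d + 1) * 2 * 4 ^ d * (B ^ 2 + 1) * 2, by positivity, fun n hn x => ?_⟩
  refine (lintegral_le_of_sphericalSin_decay (p := (d - 1) * 2) (B := B ^ 2 + 1) hn x _
    (by positivity) (fun y => ?_) fun y => ?_).trans (ENNReal.ofReal_le_ofReal ?_)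
  · exact (pow_le_one₀ (abs_nonneg _) (abs_gegenbauerKernel_le_one hn hd x y)).trans
      (by linarith [sq_nonneg B])
  · rw [pow_mul, show 4 = 2 * 2 from rfl, pow_mul, ← mul_pow, sq_abs, gegenbauerKernel_eq,
      sphericalSin]
    refine (pow_le_pow_left₀ ?_ (h n hn _ (abs_inner_unitSphere_le_one x y)) 2).trans
      (by linarith)
    positivity
  · have hs : ∑ k ∈ Finset.range (Nat.log 2 n + 1), (2 : ℝ) ^ (d * k) / 2 ^ ((d - 1) * 2 * k) ≤
        2 := by
      refine le_trans (Finset.sum_le_sum fun k _ => ?_) (sum_inv_two_pow_le (Nat.log 2 n + 1))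
      rw [div_le_iff₀ (by positivity), ← div_eq_inv_mul, le_div_iff₀ (by positivity), ← pow_add]
      refine pow_le_pow_right₀ (by norm_num) ?_
      obtain ⟨e, rfl⟩ : ∃ e, d = e + 3 := ⟨d - 3, by omega⟩
      have : (e + 3 - 1) * 2 = 2 * e + 4 := by omega
      rw [this]
      nlinarith
    calc _ ≤ (d + 1) * 2 * 4 ^ d * (B ^ 2 + 1) / n ^ d * 2 := by gcongr
      _ = _ := by ring

/-! ### Integrals of products of kernels along paths. -/

section KernelIntegrals

variable {X : Type*} [MeasurableSpace X] {μ : Measure X} [SFinite μ]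

theorem lintegral_prod_four {F : X × X × X × X → ENNReal} (hF : Measurable F) :
    ∫⁻ p, F p ∂(μ.prod (μ.prod (μ.prod μ))) =
      ∫⁻ x₁, ∫⁻ x₂, ∫⁻ x₃, ∫⁻ x₄, F (x₁, x₂, x₃, x₄) ∂μ ∂μ ∂μ ∂μ := by
  rw [lintegral_prod _ hF.aemeasurable]
  refine lintegral_congr fun x₁ => ?_
  have h1 : Measurable fun p : X × X × X => F (x₁, p) := by fun_prop
  rw [lintegral_prod _ h1.aemeasurable]
  refine lintegral_congr fun x₂ => ?_
  have h2 : Measurable fun p : X × X => F (x₁, x₂, p) := by fun_prop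
  rw [lintegral_prod _ h2.aemeasurable]

theorem lintegral_path_le {f g h : X → X → ENNReal} (hf : Measurable (Function.uncurry f))
    (hg : Measurable (Function.uncurry g)) (hh : Measurable (Function.uncurry h))
    {A B C : ENNReal} (hA : ∀ x, ∫⁻ y, f x y ∂μ ≤ A) (hB : ∀ x, ∫⁻ y, g x y ∂μ ≤ B)
    (hC : ∀ x, ∫⁻ y, h x y ∂μ ≤ C) :
    ∫⁻ p : X × X × X × X, f p.1 p.2.1 * g p.2.1 p.2.2.1 * h p.2.2.1 p.2.2.2
      ∂(μ.prod (μ.prod (μ.prod μ))) ≤ μ Set.univ * A * B * C := by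
  have mf : ∀ x, Measurable (f x) := fun x => hf.comp measurable_prodMk_left
  have mg : ∀ x, Measurable (g x) := fun x => hg.comp measurable_prodMk_left
  have mh : ∀ x, Measurable (h x) := fun x => hh.comp measurable_prodMk_left
  have hm : Measurable fun p : X × X × X × X =>
      f p.1 p.2.1 * g p.2.1 p.2.2.1 * h p.2.2.1 p.2.2.2 :=
    ((hf.comp (f := fun p : X × X × X × X => (p.1, p.2.1)) (by fun_prop)).mul
      (hg.comp (f := fun p : X × X × X × X => (p.2.1, p.2.2.1)) (by fun_prop))).mul
      (hh.comp (f := fun p : X × X × X × X => (p.2.2.1, p.2.2.2)) (by fun_prop))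
  rw [lintegral_prod_four hm]
  calc ∫⁻ x₁, ∫⁻ x₂, ∫⁻ x₃, ∫⁻ x₄, f x₁ x₂ * g x₂ x₃ * h x₃ x₄ ∂μ ∂μ ∂μ ∂μ
      ≤ ∫⁻ x₁, ∫⁻ x₂, ∫⁻ x₃, f x₁ x₂ * g x₂ x₃ * C ∂μ ∂μ ∂μ := by
        gcongr with x₁ x₂ x₃
        rw [lintegral_const_mul _ (mh x₃)]
        gcongr
        exact hC x₃
    _ ≤ ∫⁻ x₁, ∫⁻ x₂, f x₁ x₂ * B * C ∂μ ∂μ := by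
        gcongr with x₁ x₂
        rw [lintegral_mul_const _ ((mg x₂).const_mul _), lintegral_const_mul _ (mg x₂)]
        gcongr
        exact hB x₂
    _ ≤ ∫⁻ _, A * B * C ∂μ := by
        gcongr with x₁
        rw [lintegral_mul_const _ ((mf x₁).mul_const _), lintegral_mul_const _ (mf x₁)]
        gcongr
        exact hA x₁
    _ = μ Set.univ * A * B * C := by rw [lintegral_const]; ring

/-- The path is `x₂ – x₁ – x₄ – x₃`; its end `x₃` must be integrated before `x₄`, hence the swap and
the bound on `g` in its first variable. -/
theorem lintegral_bent_path_le {f g h : X → X → ENNReal} (hf : Measurable (Function.uncurry f))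
    (hg : Measurable (Function.uncurry g)) (hh : Measurable (Function.uncurry h))
    {A B C : ENNReal} (hA : ∀ x, ∫⁻ y, f x y ∂μ ≤ A) (hB : ∀ y, ∫⁻ x, g x y ∂μ ≤ B)
    (hC : ∀ x, ∫⁻ y, h x y ∂μ ≤ C) :
    ∫⁻ p : X × X × X × X, f p.1 p.2.1 * (g p.2.2.1 p.2.2.2 * h p.1 p.2.2.2)
      ∂(μ.prod (μ.prod (μ.prod μ))) ≤ μ Set.univ * A * B * C := by
  have mf : ∀ x, Measurable (f x) := fun x => hf.comp measurable_prodMk_left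
  have mg : ∀ y, Measurable (fun x => g x y) := fun x => hg.comp measurable_prodMk_right
  have mh : ∀ x, Measurable (h x) := fun x => hh.comp measurable_prodMk_left
  have hm : Measurable fun p : X × X × X × X =>
      f p.1 p.2.1 * (g p.2.2.1 p.2.2.2 * h p.1 p.2.2.2) :=
    (hf.comp (f := fun p : X × X × X × X => (p.1, p.2.1)) (by fun_prop)).mul
      ((hg.comp (f := fun p : X × X × X × X => (p.2.2.1, p.2.2.2)) (by fun_prop)).mul
      (hh.comp (f := fun p : X × X × X × X => (p.1, p.2.2.2)) (by fun_prop)))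
  rw [lintegral_prod_four hm]
  have hin : ∀ x₁, ∫⁻ x₃, ∫⁻ x₄, g x₃ x₄ * h x₁ x₄ ∂μ ∂μ ≤ B * C := by
    intro x₁
    have m2 : Measurable (Function.uncurry fun x₃ x₄ => g x₃ x₄ * h x₁ x₄) :=
      hg.mul ((mh x₁).comp measurable_snd)
    rw [lintegral_lintegral_swap m2.aemeasurable]
    calc ∫⁻ x₄, ∫⁻ x₃, g x₃ x₄ * h x₁ x₄ ∂μ ∂μ ≤ ∫⁻ x₄, B * h x₁ x₄ ∂μ := by
          gcongr with x₄
          rw [lintegral_mul_const _ (mg x₄)]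
          gcongr
          exact hB x₄
      _ ≤ B * C := by
          rw [lintegral_const_mul _ (mh x₁)]
          gcongr
          exact hC x₁
  calc ∫⁻ x₁, ∫⁻ x₂, ∫⁻ x₃, ∫⁻ x₄, f x₁ x₂ * (g x₃ x₄ * h x₁ x₄) ∂μ ∂μ ∂μ ∂μ
      ≤ ∫⁻ x₁, ∫⁻ x₂, f x₁ x₂ * (B * C) ∂μ ∂μ := by
        gcongr with x₁ x₂
        have m2 : Measurable (Function.uncurry fun x₃ x₄ => g x₃ x₄ * h x₁ x₄) :=
          hg.mul ((mh x₁).comp measurable_snd)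
        have e : ∀ x₃, ∫⁻ x₄, f x₁ x₂ * (g x₃ x₄ * h x₁ x₄) ∂μ =
            f x₁ x₂ * ∫⁻ x₄, g x₃ x₄ * h x₁ x₄ ∂μ := fun x₃ =>
          lintegral_const_mul _ (m2.comp measurable_prodMk_left)
        simp only [e]
        have m3 : Measurable fun x₃ => ∫⁻ x₄, g x₃ x₄ * h x₁ x₄ ∂μ := m2.lintegral_prod_right'
        rw [lintegral_const_mul _ m3]
        gcongr
        exact hin x₁
    _ ≤ ∫⁻ _, A * (B * C) ∂μ := by
        gcongr with x₁
        rw [lintegral_mul_const _ (mf x₁)]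
        gcongr
        exact hA x₁
    _ = μ Set.univ * A * B * C := by rw [lintegral_const]; ring

/-- Integrals over four copies of a space are invariant under the cyclic shift of the variables. -/
theorem integral_prod_four_rotate (F : X × X × X × X → ℝ) :
    ∫ p, F (p.2.1, p.2.2.1, p.2.2.2, p.1) ∂(μ.prod (μ.prod (μ.prod μ))) =
      ∫ p, F p ∂(μ.prod (μ.prod (μ.prod μ))) := by
  let e : X × X × X × X ≃ᵐ X × X × X × X :=
    (MeasurableEquiv.prodComm.trans MeasurableEquiv.prodAssoc).trans
      ((MeasurableEquiv.refl X).prodCongr MeasurableEquiv.prodAssoc)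
  have he : MeasurePreserving e (μ.prod (μ.prod (μ.prod μ))) (μ.prod (μ.prod (μ.prod μ))) :=
    ((MeasurePreserving.id μ).prod (measurePreserving_prodAssoc μ μ μ)).comp
      ((measurePreserving_prodAssoc μ (μ.prod μ) μ).comp Measure.measurePreserving_swap)
  exact he.integral_comp' F

end KernelIntegrals

/-! ### Symmetry `r ↔ q - r` and the moments of order at most four. -/

instance isFiniteMeasure_surfaceMeasure (d : ℕ) : IsFiniteMeasure (surfaceMeasure d) := by
  unfold surfaceMeasure
  infer_instance

/-- A cyclic shift of the four vertices exchanges the two classes of edges. -/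
theorem circulantIntegral_sub (d n q r : ℕ) (hr : r ≤ q) :
    circulantIntegral d n q (q - r) = circulantIntegral d n q r := by
  unfold circulantIntegral
  rw [← integral_prod_four_rotate]
  refine integral_congr_ae (Filter.Eventually.of_forall fun p => ?_)
  simp only [Nat.sub_sub_self hr]
  rw [gegenbauerKernel_comm n p.2.2.2 p.1, gegenbauerKernel_comm n p.2.1 p.1]
  ring

/-- The exponents of the decay rates of `∫ |G|ᵖ` for `p ≤ 4`. -/
noncomputable def momentExponent (d p : ℕ) : ℝ :=
  if p = 1 then -(((d : ℝ) - 1) / 2) else if p = 2 then -((d : ℝ) - 1)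
  else if p = 3 then 1 / 2 - d else -d

/-- Cauchy–Schwarz in the form `v ≤ ε u + ε⁻¹ w`; choosing `ε` as a power of `n` that balances the
two terms recovers the geometric mean of the rates. -/
theorem lintegral_ofReal_le_of_amgm {X : Type*} [MeasurableSpace X] {μ : Measure X}
    {u v w : X → ℝ} (hu : ∀ x, 0 ≤ u x) (hw : ∀ x, 0 ≤ w x) (hum : Measurable u)
    (huvw : ∀ x, v x ^ 2 ≤ u x * w x) {ε a b : ℝ} (hε : 0 < ε)
    (ha : ∫⁻ x, ENNReal.ofReal (u x) ∂μ ≤ ENNReal.ofReal a)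
    (hb : ∫⁻ x, ENNReal.ofReal (w x) ∂μ ≤ ENNReal.ofReal b) (ha0 : 0 ≤ a) (hb0 : 0 ≤ b) :
    ∫⁻ x, ENNReal.ofReal (v x) ∂μ ≤ ENNReal.ofReal (ε * a + ε⁻¹ * b) := by
  calc ∫⁻ x, ENNReal.ofReal (v x) ∂μ
      ≤ ∫⁻ x, (ENNReal.ofReal ε * ENNReal.ofReal (u x) +
          ENNReal.ofReal ε⁻¹ * ENNReal.ofReal (w x)) ∂μ := by
        gcongr with x
        rw [← ENNReal.ofReal_mul hε.le, ← ENNReal.ofReal_mul (by positivity),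
          ← ENNReal.ofReal_add (mul_nonneg hε.le (hu x)) (mul_nonneg (by positivity) (hw x))]
        refine ENNReal.ofReal_le_ofReal ?_
        have h1 : 0 ≤ ε * u x := mul_nonneg hε.le (hu x)
        have h2 : 0 ≤ ε⁻¹ * w x := mul_nonneg (by positivity) (hw x)
        refine abs_le_of_sq_le_sq' ?_ (by positivity) |>.2
        have h3 : u x * w x = (ε * u x) * (ε⁻¹ * w x) := by field_simp
        have := huvw x
        nlinarith
    _ = ENNReal.ofReal ε * ∫⁻ x, ENNReal.ofReal (u x) ∂μ +
          ENNReal.ofReal ε⁻¹ * ∫⁻ x, ENNReal.ofReal (w x) ∂μ := by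
        rw [lintegral_add_left (by fun_prop), lintegral_const_mul' _ _ ENNReal.ofReal_ne_top,
          lintegral_const_mul' _ _ ENNReal.ofReal_ne_top]
    _ ≤ ENNReal.ofReal ε * ENNReal.ofReal a + ENNReal.ofReal ε⁻¹ * ENNReal.ofReal b := by gcongr
    _ = _ := by
        rw [← ENNReal.ofReal_mul hε.le, ← ENNReal.ofReal_mul (by positivity),
          ← ENNReal.ofReal_add (by positivity) (by positivity)]

theorem measurable_gegenbauerKernel_left {d : ℕ} (n : ℕ) (x : UnitSphere d) :
    Measurable (gegenbauerKernel n d x) :=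
  ((continuous_gegenbauerKernel n d).comp (Continuous.prodMk_right x)).measurable

theorem exists_lintegral_gegenbauerKernel_pow_le (d : ℕ) (hd : 3 ≤ d) :
    ∃ C : ℝ, 0 < C ∧ surfaceMeasure d Set.univ ≤ ENNReal.ofReal C ∧ ∀ n : ℕ, 1 ≤ n →
      ∀ p : ℕ, 1 ≤ p → p ≤ 4 → ∀ x : UnitSphere d,
      ∫⁻ y, ENNReal.ofReal (|gegenbauerKernel n d x y| ^ p) ∂surfaceMeasure d ≤
        ENNReal.ofReal (C * (n : ℝ) ^ momentExponent d p) := by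
  obtain ⟨C₂, hC₂, h₂⟩ := exists_lintegral_gegenbauerKernel_sq_le d hd
  obtain ⟨C₄, hC₄, h₄⟩ := exists_lintegral_gegenbauerKernel_pow_four_le d hd
  set ω := (surfaceMeasure d Set.univ).toReal
  have hω0 : 0 ≤ ω := ENNReal.toReal_nonneg
  have hω : surfaceMeasure d Set.univ = ENNReal.ofReal ω :=
    (ENNReal.ofReal_toReal (measure_ne_top _ _)).symm
  refine ⟨C₂ + C₄ + ω, by positivity, ?_, fun n hn p hp1 hp4 x => ?_⟩
  · rw [hω]
    exact ENNReal.ofReal_le_ofReal (by linarith)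
  have hn' : (0 : ℝ) < n := by exact_mod_cast hn
  have e₂ : C₂ * n / n ^ d = C₂ * (n : ℝ) ^ (-((d : ℝ) - 1)) := by
    rw [neg_sub, Real.rpow_sub hn', Real.rpow_one, Real.rpow_natCast, mul_div_assoc]
  have e₄ : C₄ / n ^ d = C₄ * (n : ℝ) ^ (-(d : ℝ)) := by
    rw [Real.rpow_neg hn'.le, Real.rpow_natCast, div_eq_mul_inv]
  have h₂ := h₂ n hn x
  have h₄ := h₄ n hn x
  rw [e₂] at h₂
  rw [e₄] at h₄
  have hmeas : ∀ k : ℕ, Measurable fun y => |gegenbauerKernel n d x y| ^ k := fun k =>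
    ((measurable_gegenbauerKernel_left n x).abs).pow_const k
  have hweak : ∀ (c e : ℝ), c ≤ C₂ + C₄ + ω →
      ENNReal.ofReal (c * (n : ℝ) ^ e) ≤ ENNReal.ofReal ((C₂ + C₄ + ω) * (n : ℝ) ^ e) := by
    intro c e hc
    gcongr
  interval_cases p
  · have h := lintegral_ofReal_le_of_amgm (μ := surfaceMeasure d)
      (u := fun y => |gegenbauerKernel n d x y| ^ 2)
      (v := fun y => |gegenbauerKernel n d x y| ^ 1) (w := fun _ => 1) (fun _ => by positivity)
      (fun _ => zero_le_one) (hmeas 2) (fun y => by simp)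
      (ε := (n : ℝ) ^ (((d : ℝ) - 1) / 2)) (b := ω) (by positivity) h₂
      (by simp [hω]) (by positivity) hω0
    refine h.trans (le_trans (le_of_eq ?_) (hweak (C₂ + ω) _ (by linarith)))
    congr 1
    rw [← Real.rpow_neg hn'.le, mul_left_comm, ← Real.rpow_add hn']
    simp only [momentExponent, if_true]
    rw [show ((d : ℝ) - 1) / 2 + -((d : ℝ) - 1) = -(((d : ℝ) - 1) / 2) by ring]
    ring
  · exact h₂.trans (hweak _ _ (by linarith))
  · have h := lintegral_ofReal_le_of_amgm (μ := surfaceMeasure d)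
      (u := fun y => |gegenbauerKernel n d x y| ^ 4)
      (v := fun y => |gegenbauerKernel n d x y| ^ 3)
      (w := fun y => |gegenbauerKernel n d x y| ^ 2) (fun _ => by positivity)
      (fun _ => by positivity) (hmeas 4) (fun y => le_of_eq (by ring))
      (ε := (n : ℝ) ^ ((1 : ℝ) / 2)) (by positivity) h₄ h₂ (by positivity) (by positivity)
    refine h.trans (le_trans (le_of_eq ?_) (hweak (C₂ + C₄) _ (by linarith)))
    congr 1
    rw [← Real.rpow_neg hn'.le, mul_left_comm, ← Real.rpow_add hn', mul_left_comm,
      ← Real.rpow_add hn']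
    rw [show momentExponent d 3 = 1 / 2 - d by norm_num [momentExponent],
      show -((1 : ℝ) / 2) + -((d : ℝ) - 1) = 1 / 2 - d by ring,
      show (1 : ℝ) / 2 + -(d : ℝ) = 1 / 2 - d by ring]
    ring
  · refine h₄.trans ?_
    rw [show momentExponent d 4 = -d by norm_num [momentExponent]]
    exact hweak _ _ (by linarith)

/-! ### Path bounds for the circulant integral and conclusion. -/

theorem measurable_ofReal_abs_gegenbauerKernel_pow (n d p : ℕ) :
    Measurable (Function.uncurry fun x y : UnitSphere d =>
      ENNReal.ofReal (|gegenbauerKernel n d x y| ^ p)) :=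
  (((continuous_gegenbauerKernel n d).measurable.abs).pow_const p).ennreal_ofReal

/-- The edge `x₁x₄` is bounded by `1`, and the other exponents are lowered to `a`, `b`, `a`. -/
theorem abs_circulantIntegral_le_of_path {d n q r a b : ℕ} (hn : 1 ≤ n) (hd : 3 ≤ d)
    (ha : a ≤ r) (hb : b ≤ q - r) {W A B : ℝ} (hW : 0 ≤ W) (hA0 : 0 ≤ A) (hB0 : 0 ≤ B)
    (hω : surfaceMeasure d Set.univ ≤ ENNReal.ofReal W)
    (hA : ∀ x : UnitSphere d,
      ∫⁻ y, ENNReal.ofReal (|gegenbauerKernel n d x y| ^ a) ∂surfaceMeasure d ≤ ENNReal.ofReal A)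
    (hB : ∀ x : UnitSphere d,
      ∫⁻ y, ENNReal.ofReal (|gegenbauerKernel n d x y| ^ b) ∂surfaceMeasure d ≤
        ENNReal.ofReal B) :
    |circulantIntegral d n q r| ≤ W * A * B * A := by
  have hM := measurable_ofReal_abs_gegenbauerKernel_pow n d
  have h1 := fun x y : UnitSphere d => abs_gegenbauerKernel_le_one hn hd x y
  rw [← ENNReal.ofReal_le_ofReal_iff (by positivity), ← Real.norm_eq_abs, ofReal_norm,
    ENNReal.ofReal_mul (by positivity), ENNReal.ofReal_mul (by positivity),
    ENNReal.ofReal_mul (by positivity)]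
  refine (enorm_integral_le_lintegral_enorm _).trans ?_
  refine le_trans (lintegral_mono fun p => ?_) ((lintegral_path_le (hM a) (hM b) (hM a)
    hA hB hA).trans (by gcongr))
  rw [← ofReal_norm, Real.norm_eq_abs, ← ENNReal.ofReal_mul (by positivity),
    ← ENNReal.ofReal_mul (by positivity)]
  refine ENNReal.ofReal_le_ofReal ?_
  simp only [abs_mul, abs_pow]
  rw [← mul_one (_ * _ * |gegenbauerKernel n d p.2.2.1 p.2.2.2| ^ a)]
  gcongr ?_ * ?_ * ?_ * ?_
  · exact pow_le_pow_of_le_one (abs_nonneg _) (h1 _ _) ha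
  · exact pow_le_pow_of_le_one (abs_nonneg _) (h1 _ _) hb
  · exact pow_le_pow_of_le_one (abs_nonneg _) (h1 _ _) ha
  · exact pow_le_one₀ (abs_nonneg _) (h1 _ _)

/-- Simply discarding a square edge would leave exponents `3, 2, 3` and the rate `3d - 2`, one power
short. Splitting `u²v² ≤ u⁴ + v⁴` moves the weight of the discarded edge onto the opposite one. -/
theorem abs_circulantIntegral_le_of_three_two {d n q r : ℕ} (hn : 1 ≤ n) (hd : 3 ≤ d)
    (hr : 3 ≤ r) (hqr : 2 ≤ q - r) {W A B : ℝ} (hW : 0 ≤ W) (hA0 : 0 ≤ A) (hB0 : 0 ≤ B)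
    (hω : surfaceMeasure d Set.univ ≤ ENNReal.ofReal W)
    (hA : ∀ x : UnitSphere d,
      ∫⁻ y, ENNReal.ofReal (|gegenbauerKernel n d x y| ^ 3) ∂surfaceMeasure d ≤ ENNReal.ofReal A)
    (hB : ∀ x : UnitSphere d,
      ∫⁻ y, ENNReal.ofReal (|gegenbauerKernel n d x y| ^ 4) ∂surfaceMeasure d ≤
        ENNReal.ofReal B) :
    |circulantIntegral d n q r| ≤ 2 * (W * A * B * A) := by
  have hM := measurable_ofReal_abs_gegenbauerKernel_pow n d
  have h1 := fun x y : UnitSphere d => abs_gegenbauerKernel_le_one hn hd x y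
  have hA' : ∀ y : UnitSphere d,
      ∫⁻ x, ENNReal.ofReal (|gegenbauerKernel n d x y| ^ 3) ∂surfaceMeasure d ≤
        ENNReal.ofReal A := by
    intro y
    simp only [fun x => gegenbauerKernel_comm n x y]
    exact hA y
  have hpath := (lintegral_path_le (hM 3) (hM 4) (hM 3) hA hB hA).trans
    (show _ ≤ ENNReal.ofReal W * ENNReal.ofReal A * ENNReal.ofReal B * ENNReal.ofReal A by gcongr)
  have hbent := (lintegral_bent_path_le (hM 3) (hM 3) (hM 4) hA hA' hB).trans
    (show _ ≤ ENNReal.ofReal W * ENNReal.ofReal A * ENNReal.ofReal A * ENNReal.ofReal B by gcongr)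
  rw [← ENNReal.ofReal_le_ofReal_iff (by positivity), ← Real.norm_eq_abs, ofReal_norm]
  refine (enorm_integral_le_lintegral_enorm _).trans ?_
  refine le_trans (lintegral_mono (g := fun p : UnitSphere d × UnitSphere d × UnitSphere d ×
      UnitSphere d => ENNReal.ofReal (|gegenbauerKernel n d p.1 p.2.1| ^ 3) *
        ENNReal.ofReal (|gegenbauerKernel n d p.2.1 p.2.2.1| ^ 4) *
        ENNReal.ofReal (|gegenbauerKernel n d p.2.2.1 p.2.2.2| ^ 3) +
      ENNReal.ofReal (|gegenbauerKernel n d p.1 p.2.1| ^ 3) *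
        (ENNReal.ofReal (|gegenbauerKernel n d p.2.2.1 p.2.2.2| ^ 3) *
        ENNReal.ofReal (|gegenbauerKernel n d p.1 p.2.2.2| ^ 4))) fun p => ?_) ?_
  · rw [← ofReal_norm, Real.norm_eq_abs]
    simp only [← ENNReal.ofReal_mul (pow_nonneg (abs_nonneg _) _),
      ← ENNReal.ofReal_mul (mul_nonneg (pow_nonneg (abs_nonneg _) _) (pow_nonneg (abs_nonneg _) _))]
    rw [← ENNReal.ofReal_add (by positivity) (by positivity)]
    refine ENNReal.ofReal_le_ofReal ?_
    simp only [abs_mul, abs_pow]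
    calc _ ≤ |gegenbauerKernel n d p.1 p.2.1| ^ 3 * |gegenbauerKernel n d p.2.1 p.2.2.1| ^ 2 *
          |gegenbauerKernel n d p.2.2.1 p.2.2.2| ^ 3 *
          |gegenbauerKernel n d p.1 p.2.2.2| ^ 2 := by
          gcongr ?_ * ?_ * ?_ * ?_ <;>
            exact pow_le_pow_of_le_one (abs_nonneg _) (h1 _ _) (by assumption)
      _ ≤ _ := by
          generalize |gegenbauerKernel n d p.2.1 p.2.2.1| = u
          generalize |gegenbauerKernel n d p.1 p.2.2.2| = v
          have huv : u ^ 2 * v ^ 2 ≤ u ^ 4 + v ^ 4 := by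
            nlinarith [sq_nonneg (u ^ 2 - v ^ 2), sq_nonneg (u ^ 2), sq_nonneg (v ^ 2)]
          have hP := mul_le_mul_of_nonneg_left huv (mul_nonneg
            (pow_nonneg (abs_nonneg (gegenbauerKernel n d p.1 p.2.1)) 3)
            (pow_nonneg (abs_nonneg (gegenbauerKernel n d p.2.2.1 p.2.2.2)) 3))
          linarith
  · have hm : Measurable fun p : UnitSphere d × UnitSphere d × UnitSphere d × UnitSphere d =>
        ENNReal.ofReal (|gegenbauerKernel n d p.1 p.2.1| ^ 3) *
        ENNReal.ofReal (|gegenbauerKernel n d p.2.1 p.2.2.1| ^ 4) *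
        ENNReal.ofReal (|gegenbauerKernel n d p.2.2.1 p.2.2.2| ^ 3) :=
      (((hM 3).comp (measurable_fst.prodMk measurable_snd.fst)).mul
        ((hM 4).comp (measurable_snd.fst.prodMk measurable_snd.snd.fst))).mul
        ((hM 3).comp (measurable_snd.snd.fst.prodMk measurable_snd.snd.snd))
    rw [lintegral_add_left hm]
    refine (add_le_add hpath hbent).trans (le_of_eq ?_)
    rw [ENNReal.ofReal_mul (by norm_num), ENNReal.ofReal_mul (by positivity),
      ENNReal.ofReal_mul (by positivity), ENNReal.ofReal_mul (by positivity), ENNReal.ofReal_ofNat]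
    ring

theorem mul_rpow_mul_le {n C e₁ e₂ e : ℝ} (hn : 1 ≤ n) (hC : 0 < C) (he : e₁ + e₂ + e₁ ≤ e) :
    C * (C * n ^ e₁) * (C * n ^ e₂) * (C * n ^ e₁) ≤ C ^ 4 * n ^ e := by
  have hn0 : 0 < n := by linarith
  calc _ = C ^ 4 * n ^ (e₁ + e₂ + e₁) := by
        rw [Real.rpow_add hn0, Real.rpow_add hn0]
        ring
    _ ≤ _ := by gcongr

theorem proposition4 (d : ℕ) (hd : 3 ≤ d) :
    ∃ C : ℝ, ∀ ℓ : ℕ, 1 ≤ ℓ →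
      (∀ r : ℕ, 1 ≤ r → r ≤ 2 →
        |circulantIntegral d ℓ 3 r| ≤ C * (ℓ : ℝ) ^ (-(2 * (d : ℝ) + ((d : ℝ) - 5) / 2))) ∧
      (∀ r : ℕ, 1 ≤ r → r ≤ 3 →
        |circulantIntegral d ℓ 4 r| ≤ C * (ℓ : ℝ) ^ (-(2 * (d : ℝ) + ((d : ℝ) - 3) / 2))) ∧
      (∀ q : ℕ, 5 ≤ q →
        circulantIntegral d ℓ q 1 = circulantIntegral d ℓ q (q - 1) ∧
        |circulantIntegral d ℓ q 1| ≤ C * (ℓ : ℝ) ^ (-(2 * (d : ℝ) + ((d : ℝ) - 1) / 2)) ∧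
        (∀ r : ℕ, 2 ≤ r → r ≤ q - 2 →
          |circulantIntegral d ℓ q r| ≤ C * (ℓ : ℝ) ^ (-(3 * (d : ℝ) - 1)))) := by
  obtain ⟨C, hC, hω, hmom⟩ := exists_lintegral_gegenbauerKernel_pow_le d hd
  have hd' : (3 : ℝ) ≤ d := by exact_mod_cast hd
  have m₁ : momentExponent d 1 = -(((d : ℝ) - 1) / 2) := by norm_num [momentExponent]
  have m₂ : momentExponent d 2 = -((d : ℝ) - 1) := by norm_num [momentExponent]
  have m₃ : momentExponent d 3 = 1 / 2 - d := by norm_num [momentExponent]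
  have m₄ : momentExponent d 4 = -d := by norm_num [momentExponent]
  -- The factor `2` counts the two paths in `abs_circulantIntegral_le_of_three_two`.
  refine ⟨2 * C ^ 4, fun ℓ hℓ => ?_⟩
  have hℓ' : (1 : ℝ) ≤ ℓ := by exact_mod_cast hℓ
  have hC4 : ∀ e : ℝ, C ^ 4 * (ℓ : ℝ) ^ e ≤ 2 * C ^ 4 * (ℓ : ℝ) ^ e := by
    intro e
    have : 0 ≤ C ^ 4 * (ℓ : ℝ) ^ e := by positivity
    linarith
  have hpath : ∀ (q r a b : ℕ) (e : ℝ), a ≤ r → b ≤ q - r → 1 ≤ a → a ≤ 4 → 1 ≤ b → b ≤ 4 →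
      momentExponent d a + momentExponent d b + momentExponent d a ≤ e →
      |circulantIntegral d ℓ q r| ≤ 2 * C ^ 4 * (ℓ : ℝ) ^ e := by
    intro q r a b e har hbr ha1 ha4 hb1 hb4 he
    exact (abs_circulantIntegral_le_of_path hℓ hd har hbr hC.le (by positivity) (by positivity) hω
      (hmom ℓ hℓ a ha1 ha4) (hmom ℓ hℓ b hb1 hb4)).trans
      ((mul_rpow_mul_le hℓ' hC he).trans (hC4 e))
  refine ⟨?_, ?_, fun q hq => ⟨?_, ?_, ?_⟩⟩
  · have h := hpath 3 2 2 1 (-(2 * (d : ℝ) + ((d : ℝ) - 5) / 2)) (by norm_num) (by norm_num)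
      (by norm_num) (by norm_num) (by norm_num) (by norm_num) (by rw [m₁, m₂]; linarith)
    intro r hr1 hr2
    interval_cases r
    · rwa [← circulantIntegral_sub d ℓ 3 1 (by norm_num)]
    · exact h
  · have h := hpath 4 3 3 1 (-(2 * (d : ℝ) + ((d : ℝ) - 3) / 2)) (by norm_num) (by norm_num)
      (by norm_num) (by norm_num) (by norm_num) (by norm_num) (by rw [m₁, m₃]; linarith)
    intro r hr1 hr3
    interval_cases r
    · rwa [← circulantIntegral_sub d ℓ 4 1 (by norm_num)]
    -- Here `3(d - 1) ≥ 2d + (d - 3)/2` is exactly `d ≥ 3`.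
    · exact hpath 4 2 2 2 _ (by norm_num) (by norm_num)
        (by norm_num) (by norm_num) (by norm_num) (by norm_num) (by rw [m₂]; linarith)
    · exact h
  · exact (circulantIntegral_sub d ℓ q 1 (by omega)).symm
  · rw [← circulantIntegral_sub d ℓ q 1 (by omega)]
    exact hpath q (q - 1) 4 1 _ (by omega) (by omega) (by norm_num) (by norm_num) (by norm_num)
      (by norm_num) (by rw [m₁, m₄]; linarith)
  · have key : ∀ r, 3 ≤ r → r ≤ q - 2 →
        |circulantIntegral d ℓ q r| ≤ 2 * C ^ 4 * (ℓ : ℝ) ^ (-(3 * (d : ℝ) - 1)) := by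
      intro r hr3 hrq
      refine (abs_circulantIntegral_le_of_three_two hℓ hd hr3 (by omega) hC.le (by positivity)
        (by positivity) hω (hmom ℓ hℓ 3 (by norm_num) (by norm_num))
        (hmom ℓ hℓ 4 (by norm_num) (by norm_num))).trans ?_
      rw [mul_assoc 2 (C ^ 4)]
      refine mul_le_mul_of_nonneg_left (mul_rpow_mul_le hℓ' hC ?_) zero_le_two
      rw [m₃, m₄]
      linarith
    intro r hr2 hrq
    -- For `r = 2`, the complementary exponent `q - 2` is at least `3` because `q ≥ 5`.
    rcases Nat.lt_or_ge r 3 with h | h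
    · rw [← circulantIntegral_sub d ℓ q r (by omega)]
      exact key (q - r) (by omega) (by omega)
    · exact key r h hrq
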